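/- For an endomorphism $\phi$ of a group $G$, let $R(\phi)$ be the number of classes of the equivalence relation "$\beta=g\alpha\phi(g^{-1})$ for some $g\in G$", and, if $R(\phi^n)<\infty$ for all $n\ge 1$, let $$R_\phi(z)=\exp\Big(\sum_{n=1}^\infty \frac{R(\phi^n)}{n}z^n\Big).$$ Let $\phi$ be the endomorphism $g\mapsto 2g$ of the additive group $\mathbb{Z}[1/3]$, and let $|\cdot|_3$ be the $3$-adic absolute value with $|3|_3=1/3$. Then, for every integer $j\ge 1$, $R(\phi^j)$ is finite and $$R(\phi^j)=|2^j-1|\cdot|2^j-1|_3 .$$ The series in the definition of $R_\phi(z)$ converges absolutely for $|z|<1/2$, and the circle $|z|=1/2$ is a natural boundary of $R_\phi$: the function $R_\phi$ is holomorphic on the disc $|z|<1/2$ and cannot be continued analytically to a neighbourhood of any point of the circle. Moreover $R_\phi$ has (boundary) zeros at all points $\tfrac12 e^{2\pi i k/3^r}\neq\tfrac12$, that is, for all integers $r\ge 1$ and $k$ with $3^r\nmid k$, one has $R_\phi(z)\to 0$ as $z\to \tfrac12 e^{2\pi i k/3^r}$ within the disc $|z|<1/2$. -/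

import Mathlib

open Filter Topology

/-- The `φ`-twisted conjugacy relation: `b = g a φ(g⁻¹)` for some `g`. -/
def twistedConjSetoid {G : Type*} [Group G] (φ : Monoid.End G) : Setoid G where
  r a b := ∃ g : G, b = g * a * φ g⁻¹
  iseqv :=
    { refl := fun a => ⟨1, by simp⟩
      symm := by
        rintro a b ⟨g, rfl⟩
        exact ⟨g⁻¹, by simp [mul_assoc]⟩
      trans := by
        rintro a b c ⟨g, rfl⟩ ⟨h, rfl⟩
        exact ⟨h * g, by simp [mul_assoc]⟩ }

/-- The set of `φ`-twisted conjugacy classes. -/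
def TwistedConjClasses {G : Type*} [Group G] (φ : Monoid.End G) : Type _ :=
  Quotient (twistedConjSetoid φ)

/-- The Reidemeister number `R(φ)`: the number of `φ`-twisted conjugacy classes
(meaningful when there are finitely many of them). -/
noncomputable def reidemeisterNumber {G : Type*} [Group G] (φ : Monoid.End G) : ℕ :=
  Nat.card (TwistedConjClasses φ)

/-- The term `R(φ ^ n) / n * z ^ n` of the series in the exponent of the zeta function. -/
noncomputable def reidemeisterZetaTerm {G : Type*} [Group G] (φ : Monoid.End G) (z : ℂ)
    (n : ℕ) : ℂ :=
  (reidemeisterNumber (φ ^ n) : ℂ) / (n : ℂ) * z ^ n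

/-- The Reidemeister zeta function `R_φ(z) = exp (∑_{n ≥ 1} R(φ ^ n) / n * z ^ n)`
(meaningful where the series converges). -/
noncomputable def reidemeisterZeta {G : Type*} [Group G] (φ : Monoid.End G) (z : ℂ) : ℂ :=
  Complex.exp (∑' n : ℕ, reidemeisterZetaTerm φ z (n + 1))

/-- The circle `|z| = ρ` is a natural boundary of `f`: `f` is holomorphic on the open disc
`|z| < ρ`, and no point of the circle has a neighbourhood to which `f` continues analytically. -/
def HasNaturalBoundaryCircle (f : ℂ → ℂ) (ρ : ℝ) : Prop :=
  0 < ρ ∧ DifferentiableOn ℂ f (Metric.ball 0 ρ) ∧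
    ∀ p ∈ Metric.sphere (0 : ℂ) ρ,
      ¬ ∃ g : ℂ → ℂ, AnalyticAt ℂ g p ∧ g =ᶠ[𝓝[Metric.ball 0 ρ] p] f

/-- The ring `ℤ[1/3]`. -/
abbrev ZInvThree : Type := Localization.Away (3 : ℤ)

/-- The endomorphism `g ↦ 2g` of the additive group `ℤ[1/3]` (written multiplicatively). -/
noncomputable def doubling : Monoid.End (Multiplicative ZInvThree) :=
  AddMonoidHom.toMultiplicative (AddMonoidHom.mulLeft (2 : ZInvThree))

/-! Twisted classes of `doubling ^ j` are cosets of (2^j - 1)ℤ[1/3]. As 3 is a unit there, only the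
prime-to-3 part M of 2^j - 1 matters, and the quotient is ℤ/M. Hence log R_φ(z) = A(2z) - A(z) with
A = `padicTwistedLog`. Since |2^n - 1|₃ is 1 for odd n and |m|₃/3 for n = 2m, A reduces to
logarithms and D(w²), where D = `padicLogDefect` satisfies D(w) = D(w³)/9 + (2/9) log(1 - w³).
Iterating this equation bounds Re D above and forces Re D → -∞ at every root of unity of 3-power
order, so R_φ → 0 at the stated points. These are dense in the circle: a continuation would have
accumulating zeros and vanish identically near a boundary point, whereas R_φ is an exponential. -/

/-! ### Reidemeister numbers of the doubling map -/

theorem doubling_pow_apply (j : ℕ) (x : ZInvThree) :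
    ((doubling ^ j) (Multiplicative.ofAdd x)).toAdd = 2 ^ j * x := by
  induction j with
  | zero => simp
  | succ j ih =>
    rw [pow_succ']
    calc (doubling ((doubling ^ j) (Multiplicative.ofAdd x))).toAdd
        = 2 * ((doubling ^ j) (Multiplicative.ofAdd x)).toAdd := rfl
      _ = _ := by rw [ih]; ring

theorem finite_and_card_twistedConjClasses_doubling_pow {j M v : ℕ} (hM : 0 < M)
    (h3 : M.Coprime 3) (h : 2 ^ j - 1 = (3 : ℤ) ^ v * M) :
    Finite (TwistedConjClasses (doubling ^ j)) ∧ reidemeisterNumber (doubling ^ j) = M := by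
  have : NeZero M := ⟨hM.ne'⟩
  have hu : IsUnit ((Int.castRingHom (ZMod M)) 3) := by
    have := (ZMod.isUnit_iff_coprime 3 M).2 h3.symm
    simpa using this
  let ψ : ZInvThree →+* ZMod M := IsLocalization.Away.lift (3 : ℤ) hu
  have hψ (n : ℤ) : ψ (algebraMap ℤ ZInvThree n) = n := by
    simp [ψ]
  have hunit : IsUnit (algebraMap ℤ ZInvThree 3) :=
    IsLocalization.Away.algebraMap_isUnit (3 : ℤ)
  have hM' : (2 : ZInvThree) ^ j - 1 = algebraMap ℤ ZInvThree 3 ^ v * algebraMap ℤ ZInvThree M := by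
    have := congrArg (algebraMap ℤ ZInvThree) h
    simpa only [map_mul, map_pow, map_sub, map_one, map_ofNat] using this
  have hker (x : ZInvThree) : ψ x = 0 ↔ ∃ g, x = (2 ^ j - 1) * g := by
    constructor
    · intro hx
      obtain ⟨n, a, ha⟩ := IsLocalization.Away.surj (3 : ℤ) x
      have h1 : ((a : ℤ) : ZMod M) = 0 := by
        rw [← hψ, ← ha, map_mul, hx, zero_mul]
      obtain ⟨b, rfl⟩ := (ZMod.intCast_zmod_eq_zero_iff_dvd a M).1 h1
      obtain ⟨u, hu'⟩ := hunit
      -- With x * 3^n = M * b, the witness is 3^(-v) * 3^(-n) * b.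
      refine ⟨↑(u⁻¹ ^ v) * ↑(u⁻¹ ^ n) * algebraMap ℤ ZInvThree b, ?_⟩
      rw [hM', ← hu']
      rw [← hu', map_mul] at ha
      have e1 : ((u : ZInvThree)) ^ v * ↑(u⁻¹ ^ v) = 1 := by
        rw [← Units.val_pow_eq_pow_val, ← Units.val_mul]; simp
      have e2 : ((u : ZInvThree)) ^ n * ↑(u⁻¹ ^ n) = 1 := by
        rw [← Units.val_pow_eq_pow_val, ← Units.val_mul]; simp
      calc x = x * (u ^ n * ↑(u⁻¹ ^ n)) := by rw [e2, mul_one]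
        _ = (x * u ^ n) * ↑(u⁻¹ ^ n) := by ring
        _ = 1 * (algebraMap ℤ ZInvThree M * algebraMap ℤ ZInvThree b) * ↑(u⁻¹ ^ n) := by
          rw [ha, one_mul]
        _ = _ := by rw [← e1]; ring
    · rintro ⟨g, rfl⟩
      rw [hM', map_mul, map_mul, hψ]
      simp
  have hrel (a b : Multiplicative ZInvThree) :
      (twistedConjSetoid (doubling ^ j)).r a b ↔ ψ a.toAdd = ψ b.toAdd := by
    rw [← sub_eq_zero, ← map_sub, hker]
    constructor
    · rintro ⟨g, rfl⟩
      refine ⟨g.toAdd, ?_⟩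
      have := doubling_pow_apply j g.toAdd
      rw [ofAdd_toAdd] at this
      simp only [map_inv, toAdd_mul, toAdd_inv, this]
      ring
    · rintro ⟨g, hg⟩
      refine ⟨Multiplicative.ofAdd g, ?_⟩
      apply Multiplicative.toAdd.injective
      simp only [map_inv, toAdd_mul, toAdd_inv, doubling_pow_apply, toAdd_ofAdd]
      linear_combination -hg
  have hbij : Function.Bijective (Quotient.lift (s := twistedConjSetoid (doubling ^ j))
      (fun a => ψ a.toAdd) (fun a b hab => (hrel a b).1 hab)) := by
    constructor
    · rintro ⟨a⟩ ⟨b⟩ hab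
      exact Quotient.sound ((hrel a b).2 hab)
    · intro y
      refine ⟨Quotient.mk _ (Multiplicative.ofAdd (algebraMap ℤ ZInvThree (y.val : ℤ))), ?_⟩
      simp [Quotient.lift_mk]
  let e : TwistedConjClasses (doubling ^ j) ≃ ZMod M := Equiv.ofBijective _ hbij
  exact ⟨Finite.of_equiv _ e.symm, (Nat.card_congr e).trans (Nat.card_zmod M)⟩

theorem padicNorm_three_two_pow_sub_one_of_odd {n : ℕ} (hn : Odd n) :
    padicNorm 3 ((2 : ℚ) ^ n - 1) = 1 := by
  have h : ¬ (3 : ℤ) ∣ 2 ^ n - 1 := by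
    intro h
    have h2 : ((2 : ℤ) ^ n - 1) ≡ (-1) ^ n - 1 [ZMOD 3] :=
      Int.ModEq.sub_right _ (Int.ModEq.pow n (by decide))
    rw [hn.neg_one_pow] at h2
    have := (Int.modEq_zero_iff_dvd.2 h).symm.trans h2
    revert this; decide
  have := (padicNorm.int_eq_one_iff (p := 3) (2 ^ n - 1)).2 (by exact_mod_cast h)
  exact_mod_cast this

/-- Lifting the exponent for 4^m - 1^m: the factor 1/3 comes from 4 - 1 = 3. -/
theorem padicNorm_three_two_pow_two_mul_sub_one (m : ℕ) :
    padicNorm 3 ((2 : ℚ) ^ (2 * m) - 1) = padicNorm 3 m / 3 := by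
  rcases eq_or_ne m 0 with rfl | hm
  · simp
  have h1 : 1 < 4 ^ m := Nat.one_lt_pow hm (by norm_num)
  have h : padicValNat 3 (4 ^ m - 1) = 1 + padicValNat 3 m := by
    have := padicValNat.pow_sub_pow (p := 3) (x := 4) (y := 1) (by decide) (by norm_num)
      (by norm_num) (by norm_num) hm
    simpa using this
  have e : (2 : ℚ) ^ (2 * m) - 1 = ((4 ^ m - 1 : ℕ) : ℚ) := by
    rw [Nat.cast_sub h1.le, pow_mul]; norm_num
  rw [e, padicNorm.eq_zpow_of_nonzero (by exact_mod_cast (by omega : 4 ^ m - 1 ≠ 0)),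
    padicNorm.eq_zpow_of_nonzero (by exact_mod_cast hm), padicValRat.of_nat, padicValRat.of_nat, h]
  push_cast
  rw [neg_add, zpow_add₀ (by norm_num)]
  norm_num
  ring

theorem finite_and_reidemeisterNumber_doubling_pow {j : ℕ} (hj : 1 ≤ j) :
    Finite (TwistedConjClasses (doubling ^ j)) ∧
      (reidemeisterNumber (doubling ^ j) : ℚ) =
        |(2 : ℚ) ^ j - 1| * padicNorm 3 ((2 : ℚ) ^ j - 1) := by
  have h1 : 1 < 2 ^ j := Nat.one_lt_pow (by omega) (by norm_num)
  obtain ⟨v, M, hM, h⟩ := Nat.exists_eq_pow_mul_and_not_dvd (n := 2 ^ j - 1) (by omega) 3 (by norm_num)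
  have hM0 : 0 < M := Nat.pos_of_ne_zero (by rintro rfl; simp at hM)
  have hcop : M.Coprime 3 := ((Nat.Prime.coprime_iff_not_dvd Nat.prime_three).2 hM).symm
  have hz : (2 : ℤ) ^ j - 1 = 3 ^ v * M := by
    have := congrArg (Nat.cast : ℕ → ℤ) h
    rw [Nat.cast_sub h1.le] at this
    exact_mod_cast this
  have hq : (2 : ℚ) ^ j - 1 = 3 ^ v * M := by exact_mod_cast hz
  obtain ⟨hf, hc⟩ := finite_and_card_twistedConjClasses_doubling_pow hM0 hcop hz
  refine ⟨hf, ?_⟩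
  rw [hc, hq, padicNorm.mul, (padicNorm.nat_eq_one_iff M).2 hM,
    IsAbsoluteValue.abv_pow (padicNorm 3)]
  have h3 := padicNorm.padicNorm_p (p := 3) (by norm_num)
  push_cast at h3
  rw [h3, abs_of_nonneg (by positivity), inv_pow]
  field_simp

/-! ### Power series with bounded coefficients -/

/-- Turns a series in w^k into one in w, ready for comparing coefficients. -/
theorem HasSum.ite_dvd {f : ℕ → ℂ} {a : ℂ} (hf : HasSum f a) {k : ℕ} (hk : 0 < k) :
    HasSum (fun n => if k ∣ n then f (n / k) else 0) a := by
  have hinj : Function.Injective (fun m : ℕ => k * m) := fun a b h => Nat.eq_of_mul_eq_mul_left hk h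
  rw [← hinj.hasSum_iff]
  · have e : (fun n => if k ∣ n then f (n / k) else 0) ∘ (fun m => k * m) = f := by
      funext m
      simp [Nat.mul_div_cancel_left _ hk]
    rwa [e]
  · intro n hn
    rw [if_neg]
    rintro ⟨m, rfl⟩
    exact hn ⟨m, rfl⟩

theorem summable_coeff_div_mul_pow {c : ℕ → ℂ} (hc : ∀ n, ‖c n‖ ≤ 1) {w : ℂ} (hw : ‖w‖ < 1) :
    Summable (fun n : ℕ => c n / n * w ^ n) := by
  refine Summable.of_norm_bounded (summable_geometric_of_lt_one (norm_nonneg w) hw) fun n => ?_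
  rw [norm_mul, norm_div, norm_pow, Complex.norm_natCast]
  refine mul_le_of_le_one_left (by positivity) ?_
  rcases Nat.eq_zero_or_pos n with rfl | hn
  · simp
  · exact (div_le_one (by positivity)).2 ((hc n).trans (by exact_mod_cast hn))

theorem norm_tsum_coeff_div_mul_pow_le {c : ℕ → ℂ} (hc : ∀ n, ‖c n‖ ≤ 1) {w : ℂ} {ρ : ℝ}
    (hw : ‖w‖ ≤ ρ) (hρ : ρ < 1) : ‖∑' n : ℕ, c n / n * w ^ n‖ ≤ (1 - ρ)⁻¹ := by
  have h0 : 0 ≤ ρ := (norm_nonneg w).trans hw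
  refine tsum_of_norm_bounded (hasSum_geometric_of_lt_one h0 hρ) fun n => ?_
  rw [norm_mul, norm_div, norm_pow, Complex.norm_natCast]
  have h1 : ‖c n‖ / n ≤ 1 := by
    rcases Nat.eq_zero_or_pos n with rfl | hn
    · simp
    · exact (div_le_one (by positivity)).2 ((hc n).trans (by exact_mod_cast hn))
  calc ‖c n‖ / n * ‖w‖ ^ n ≤ 1 * ρ ^ n := by gcongr
    _ = ρ ^ n := one_mul _

theorem differentiableOn_tsum_coeff_div_mul_pow {c : ℕ → ℂ} (hc : ∀ n, ‖c n‖ ≤ 1) :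
    DifferentiableOn ℂ (fun w => ∑' n : ℕ, c n / n * w ^ n) (Metric.ball 0 1) := by
  intro w hw
  obtain ⟨ρ, hwρ, hρ⟩ := exists_between (mem_ball_zero_iff.1 hw)
  have h0 : 0 ≤ ρ := (norm_nonneg w).trans hwρ.le
  have hd : DifferentiableOn ℂ (fun w => ∑' n : ℕ, c n / n * w ^ n) (Metric.ball 0 ρ) := by
    refine Complex.differentiableOn_tsum_of_summable_norm
      (summable_geometric_of_lt_one h0 hρ) (fun n => by fun_prop) Metric.isOpen_ball
      fun n z hz => ?_
    have hz' := (mem_ball_zero_iff.1 hz).le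
    rw [norm_mul, norm_div, norm_pow, Complex.norm_natCast]
    have h1 : ‖c n‖ / n ≤ 1 := by
      rcases Nat.eq_zero_or_pos n with rfl | hn
      · simp
      · exact (div_le_one (by positivity)).2 ((hc n).trans (by exact_mod_cast hn))
    calc ‖c n‖ / n * ‖z‖ ^ n ≤ 1 * ρ ^ n := by gcongr
      _ = ρ ^ n := one_mul _
  exact (hd.differentiableAt (Metric.isOpen_ball.mem_nhds (by simpa using hwρ))).differentiableWithinAt

/-- The power series `∑ (|n|₃ - 1) / n * w ^ n`. -/
noncomputable def padicLogDefect (w : ℂ) : ℂ :=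
  ∑' n : ℕ, ((padicNorm 3 n : ℂ) - 1) / n * w ^ n

/-- The power series `∑ |2 ^ n - 1|₃ / n * w ^ n`. -/
noncomputable def padicTwistedLog (w : ℂ) : ℂ :=
  ∑' n : ℕ, (padicNorm 3 ((2 : ℚ) ^ n - 1) : ℂ) / n * w ^ n

theorem norm_padicNorm_three_sub_one_le (n : ℕ) : ‖(padicNorm 3 n : ℂ) - 1‖ ≤ 1 := by
  have h0 : (0 : ℝ) ≤ padicNorm 3 n := by exact_mod_cast padicNorm.nonneg (p := 3) (n : ℚ)
  have h1 : ((padicNorm 3 n : ℚ) : ℝ) ≤ 1 := by exact_mod_cast padicNorm.of_nat (p := 3) n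
  have e : (padicNorm 3 n : ℂ) - 1 = (((padicNorm 3 n : ℝ) - 1 : ℝ) : ℂ) := by push_cast; rfl
  rw [e, Complex.norm_real, Real.norm_eq_abs, abs_le]
  constructor <;> linarith

theorem norm_padicNorm_three_two_pow_sub_one_le (n : ℕ) :
    ‖(padicNorm 3 ((2 : ℚ) ^ n - 1) : ℂ)‖ ≤ 1 := by
  have h0 : (0 : ℝ) ≤ padicNorm 3 ((2 : ℚ) ^ n - 1) := by exact_mod_cast padicNorm.nonneg (p := 3) _
  have h1 : ((padicNorm 3 ((2 : ℚ) ^ n - 1) : ℚ) : ℝ) ≤ 1 := by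
    exact_mod_cast padicNorm.of_int (p := 3) ((2 : ℤ) ^ n - 1)
  have e : (padicNorm 3 ((2 : ℚ) ^ n - 1) : ℂ) =
    ((padicNorm 3 ((2 : ℚ) ^ n - 1) : ℝ) : ℂ) := by push_cast; rfl
  rw [e, Complex.norm_real, Real.norm_eq_abs, abs_le]
  constructor <;> linarith

theorem hasSum_padicLogDefect {w : ℂ} (hw : ‖w‖ < 1) :
    HasSum (fun n : ℕ => ((padicNorm 3 n : ℂ) - 1) / n * w ^ n) (padicLogDefect w) :=
  (summable_coeff_div_mul_pow norm_padicNorm_three_sub_one_le hw).hasSum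

theorem hasSum_padicTwistedLog {w : ℂ} (hw : ‖w‖ < 1) :
    HasSum (fun n : ℕ => (padicNorm 3 ((2 : ℚ) ^ n - 1) : ℂ) / n * w ^ n) (padicTwistedLog w) :=
  (summable_coeff_div_mul_pow norm_padicNorm_three_two_pow_sub_one_le hw).hasSum

/-! ### Functional equations -/

theorem norm_pow_lt_one {w : ℂ} (hw : ‖w‖ < 1) {k : ℕ} (hk : k ≠ 0) : ‖w ^ k‖ < 1 := by
  rw [norm_pow]; exact pow_lt_one₀ (norm_nonneg _) hw hk

/-- Terms with 3 ∤ n vanish; for n = 3m, |3m|₃ - 1 = (|m|₃ - 1)/3 - 2/3, and dividing by 3m gives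
the weights 1/9 and 2/9. -/
theorem padicLogDefect_eq {w : ℂ} (hw : ‖w‖ < 1) :
    padicLogDefect w = 1 / 9 * padicLogDefect (w ^ 3) + 2 / 9 * Complex.log (1 - w ^ 3) := by
  have hw3 := norm_pow_lt_one hw (k := 3) (by norm_num)
  have h1 := (((hasSum_padicLogDefect hw3).mul_left (1 / 9)).sub
    ((Complex.hasSum_taylorSeries_neg_log hw3).mul_left (2 / 9))).ite_dvd (k := 3) (by norm_num)
  rw [mul_neg, sub_neg_eq_add] at h1
  refine (hasSum_padicLogDefect hw).unique ?_
  convert h1 using 2 with n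
  split_ifs with hn
  · obtain ⟨m, rfl⟩ := hn
    rw [Nat.mul_div_cancel_left _ (by norm_num), ← pow_mul]
    rcases eq_or_ne m 0 with rfl | hm
    · simp
    have hm' : (m : ℂ) ≠ 0 := by exact_mod_cast hm
    have e : padicNorm 3 ((3 * m : ℕ) : ℚ) = padicNorm 3 m / 3 := by
      push_cast
      rw [padicNorm.mul]
      have := padicNorm.padicNorm_p (p := 3) (by norm_num)
      push_cast at this
      rw [this]; ring
    rw [e]
    push_cast
    field_simp
    ring
  · have : padicNorm 3 (n : ℚ) = 1 := (padicNorm.nat_eq_one_iff n).2 hn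
    simp [this]

theorem padicTwistedLog_eq {w : ℂ} (hw : ‖w‖ < 1) :
    padicTwistedLog w = -Complex.log (1 - w) + 1 / 3 * Complex.log (1 - w ^ 2) +
      1 / 6 * padicLogDefect (w ^ 2) := by
  have hw2 := norm_pow_lt_one hw (k := 2) (by norm_num)
  have h1 := (((hasSum_padicLogDefect hw2).mul_left (1 / 6)).sub
    ((Complex.hasSum_taylorSeries_neg_log hw2).mul_left (1 / 3))).ite_dvd (k := 2) (by norm_num)
  have h2 := (Complex.hasSum_taylorSeries_neg_log hw).add h1
  have e : -Complex.log (1 - w) + 1 / 3 * Complex.log (1 - w ^ 2) +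
      1 / 6 * padicLogDefect (w ^ 2) = -Complex.log (1 - w) +
      (1 / 6 * padicLogDefect (w ^ 2) - 1 / 3 * -Complex.log (1 - w ^ 2)) := by ring
  rw [e]
  refine (hasSum_padicTwistedLog hw).unique ?_
  convert h2 using 2 with n
  · split_ifs with hn
    · obtain ⟨m, rfl⟩ := hn
      rw [Nat.mul_div_cancel_left _ (by norm_num), ← pow_mul,
        padicNorm_three_two_pow_two_mul_sub_one]
      rcases eq_or_ne m 0 with rfl | hm
      · simp
      have hm' : (m : ℂ) ≠ 0 := by exact_mod_cast hm
      push_cast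
      field_simp
      ring
    · have : Odd n := by rwa [← Nat.not_even_iff_odd, even_iff_two_dvd]
      simp [padicNorm_three_two_pow_sub_one_of_odd this, div_eq_inv_mul]

/-! ### Behaviour at roots of unity of 3-power order -/

theorem log_one_sub_re_le {w : ℂ} (hw : ‖w‖ < 1) : (Complex.log (1 - w)).re ≤ Real.log 2 := by
  rw [Complex.log_re]
  have hpos : 0 < ‖1 - w‖ := by
    rw [norm_pos_iff, sub_ne_zero]
    rintro rfl
    simp at hw
  refine Real.log_le_log hpos ?_
  have := norm_sub_le (1 : ℂ) w
  rw [norm_one] at this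
  linarith

theorem padicLogDefect_re_eq {w : ℂ} (hw : ‖w‖ < 1) :
    (padicLogDefect w).re =
      1 / 9 * (padicLogDefect (w ^ 3)).re + 2 / 9 * (Complex.log (1 - w ^ 3)).re := by
  rw [padicLogDefect_eq hw]
  have h1 : (1 / 9 : ℂ) = ((1 / 9 : ℝ) : ℂ) := by push_cast; rfl
  have h2 : (2 / 9 : ℂ) = ((2 / 9 : ℝ) : ℂ) := by push_cast; rfl
  rw [Complex.add_re, h1, h2, Complex.re_ofReal_mul, Complex.re_ofReal_mul]

theorem padicLogDefect_re_le {w : ℂ} (hw : ‖w‖ < 1) : (padicLogDefect w).re ≤ Real.log 2 := by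
  have hlog : 0 < Real.log 2 := Real.log_pos (by norm_num)
  -- The crude bound on the disc of radius ‖w‖, which cubing preserves, shrinks by 1/9 at each
  -- iteration; the log terms cost at most (1/9 + 2/9) log 2 ≤ log 2.
  have key (N : ℕ) : ∀ v : ℂ, ‖v‖ ≤ ‖w‖ →
      (padicLogDefect v).re ≤ Real.log 2 + (1 / 9) ^ N * (1 - ‖w‖)⁻¹ := by
    induction N with
    | zero =>
      intro v hv
      have := norm_tsum_coeff_div_mul_pow_le norm_padicNorm_three_sub_one_le hv hw
      have h2 := (Complex.re_le_norm (padicLogDefect v)).trans this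
      simp only [pow_zero, one_mul]
      linarith
    | succ N ih =>
      intro v hv
      have hv1 := hv.trans_lt hw
      have h3 : ‖v ^ 3‖ ≤ ‖w‖ := by
        rw [norm_pow]
        exact (pow_le_of_le_one (norm_nonneg _) hv1.le (by norm_num)).trans hv
      have h1 := ih _ h3
      have h2 := log_one_sub_re_le (h3.trans_lt hw)
      rw [padicLogDefect_re_eq hv1, pow_succ _ N]
      linarith
  have hlim : Tendsto (fun N : ℕ => Real.log 2 + (1 / 9 : ℝ) ^ N * (1 - ‖w‖)⁻¹) atTop
      (𝓝 (Real.log 2 + 0 * (1 - ‖w‖)⁻¹)) :=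
    ((tendsto_pow_atTop_nhds_zero_of_lt_one (by norm_num) (by norm_num)).mul_const _).const_add _
  rw [zero_mul, add_zero] at hlim
  exact ge_of_tendsto' hlim fun N => key N w le_rfl

theorem tendsto_pow_nhdsWithin_ball (ζ : ℂ) {k : ℕ} (hk : k ≠ 0) :
    Tendsto (fun w : ℂ => w ^ k) (𝓝[Metric.ball 0 1] ζ) (𝓝[Metric.ball 0 1] (ζ ^ k)) := by
  refine tendsto_nhdsWithin_iff.2
    ⟨((continuous_pow k).tendsto ζ).mono_left nhdsWithin_le_nhds, ?_⟩
  filter_upwards [self_mem_nhdsWithin] with w hw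
  exact mem_ball_zero_iff.2 (norm_pow_lt_one (mem_ball_zero_iff.1 hw) hk)

theorem tendsto_log_one_sub_re_atBot :
    Tendsto (fun w : ℂ => (Complex.log (1 - w)).re) (𝓝[Metric.ball 0 1] 1) atBot := by
  simp only [Complex.log_re]
  refine Real.tendsto_log_nhdsNE_zero.comp (tendsto_nhdsWithin_iff.2 ⟨?_, ?_⟩)
  · have : Continuous fun w : ℂ => ‖1 - w‖ := by fun_prop
    have h := this.tendsto 1
    simp only [sub_self, norm_zero] at h
    exact h.mono_left nhdsWithin_le_nhds
  · filter_upwards [self_mem_nhdsWithin] with w hw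
    simp only [Set.mem_compl_iff, Set.mem_singleton_iff, norm_eq_zero, sub_eq_zero]
    rintro rfl
    simp at hw

/-- In the functional equation one summand tends to -∞ while the other is bounded above: the
logarithm diverges when ζ³ = 1, and the D(w³) term does so in the inductive step. -/
theorem tendsto_padicLogDefect_re_atBot (s : ℕ) {ζ : ℂ} (hζ : ζ ^ 3 ^ (s + 1) = 1) :
    Tendsto (fun w => (padicLogDefect w).re) (𝓝[Metric.ball 0 1] ζ) atBot := by
  induction s generalizing ζ with
  | zero =>
    have h3 : ζ ^ 3 = 1 := by simpa using hζ
    have hp := tendsto_pow_nhdsWithin_ball ζ (k := 3) (by norm_num)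
    rw [h3] at hp
    have h := tendsto_log_one_sub_re_atBot.comp hp
    refine tendsto_atBot_mono' _ ?_ (tendsto_atBot_add_const_left _ (1 / 9 * Real.log 2)
      (h.const_mul_atBot (by norm_num : (0 : ℝ) < 2 / 9)))
    filter_upwards [self_mem_nhdsWithin] with w hw
    rw [mem_ball_zero_iff] at hw
    have := padicLogDefect_re_le (norm_pow_lt_one hw (k := 3) (by norm_num))
    rw [padicLogDefect_re_eq hw]
    simp only [Function.comp]
    linarith
  | succ s ih =>
    have h3 : (ζ ^ 3) ^ 3 ^ (s + 1) = 1 := by rw [← pow_mul, ← pow_succ', hζ]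
    have h := (ih h3).comp (tendsto_pow_nhdsWithin_ball ζ (k := 3) (by norm_num))
    refine tendsto_atBot_mono' _ ?_ (tendsto_atBot_add_const_right _ (2 / 9 * Real.log 2)
      (h.const_mul_atBot (by norm_num : (0 : ℝ) < 1 / 9)))
    filter_upwards [self_mem_nhdsWithin] with w hw
    rw [mem_ball_zero_iff] at hw
    have := log_one_sub_re_le (norm_pow_lt_one hw (k := 3) (by norm_num))
    rw [padicLogDefect_re_eq hw]
    simp only [Function.comp]
    linarith

theorem tendsto_log_one_sub_re {ζ : ℂ} (hζ : ζ ≠ 1) (s : Set ℂ) :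
    Tendsto (fun w : ℂ => (Complex.log (1 - w)).re) (𝓝[s] ζ) (𝓝 (Complex.log (1 - ζ)).re) := by
  simp only [Complex.log_re]
  have h : ContinuousAt (fun w : ℂ => Real.log ‖1 - w‖) ζ := by
    refine ContinuousAt.log (by fun_prop) ?_
    rw [norm_ne_zero_iff, sub_ne_zero]
    exact hζ.symm
  exact h.tendsto.mono_left nhdsWithin_le_nhds

theorem tendsto_padicTwistedLog_re_atBot {r : ℕ} {ζ : ℂ} (hζ : ζ ^ 3 ^ r = 1) (h1 : ζ ≠ 1) :
    Tendsto (fun w => (padicTwistedLog w).re) (𝓝[Metric.ball 0 1] ζ) atBot := by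
  obtain ⟨s, rfl⟩ : ∃ s, r = s + 1 := by
    refine Nat.exists_eq_succ_of_ne_zero ?_
    rintro rfl
    exact h1 (by simpa using hζ)
  -- ζ has odd order, so both logarithms stay finite at ζ and only D(w²) diverges.
  have h2 : ζ ^ 2 ≠ 1 := by
    intro h2
    have hd : orderOf ζ ∣ Nat.gcd 2 (3 ^ (s + 1)) :=
      Nat.dvd_gcd (orderOf_dvd_of_pow_eq_one h2) (orderOf_dvd_of_pow_eq_one hζ)
    rw [Nat.Coprime.gcd_eq_one (Nat.Coprime.pow_right _ (by norm_num)), Nat.dvd_one,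
      orderOf_eq_one_iff] at hd
    exact h1 hd
  have hp := tendsto_pow_nhdsWithin_ball ζ (k := 2) (by norm_num)
  have t1 := (tendsto_log_one_sub_re h1 (Metric.ball 0 1)).neg
  have t2 := ((tendsto_log_one_sub_re h2 (Metric.ball 0 1)).comp hp).const_mul (1 / 3)
  have t3 := ((tendsto_padicLogDefect_re_atBot s
    (ζ := ζ ^ 2) (by rw [← pow_mul, mul_comm, pow_mul, hζ, one_pow])).comp hp).const_mul_atBot
    (by norm_num : (0 : ℝ) < 1 / 6)
  refine ((t1.add t2).add_atBot t3).congr' ?_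
  filter_upwards [self_mem_nhdsWithin] with w hw
  rw [padicTwistedLog_eq (mem_ball_zero_iff.1 hw)]
  have h1 : (1 / 3 : ℂ) = ((1 / 3 : ℝ) : ℂ) := by push_cast; rfl
  have h2 : (1 / 6 : ℂ) = ((1 / 6 : ℝ) : ℂ) := by push_cast; rfl
  rw [Complex.add_re, Complex.add_re, h1, h2, Complex.re_ofReal_mul, Complex.re_ofReal_mul,
    Complex.neg_re]
  rfl

/-! ### The zeta function and its boundary zeros -/

theorem reidemeisterZetaTerm_doubling (z : ℂ) (n : ℕ) :
    reidemeisterZetaTerm doubling z n =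
      (padicNorm 3 ((2 : ℚ) ^ n - 1) : ℂ) / n * (2 * z) ^ n -
        (padicNorm 3 ((2 : ℚ) ^ n - 1) : ℂ) / n * z ^ n := by
  rcases Nat.eq_zero_or_pos n with rfl | hn
  · simp [reidemeisterZetaTerm]
  have h := (finite_and_reidemeisterNumber_doubling_pow hn).2
  rw [abs_of_nonneg (sub_nonneg.2 (one_le_pow₀ (by norm_num)))] at h
  have h' := congrArg (Rat.cast : ℚ → ℂ) h
  push_cast at h'
  rw [reidemeisterZetaTerm, h', mul_pow]
  ring

theorem hasSum_reidemeisterZetaTerm_doubling {z : ℂ} (hz : ‖z‖ < 1 / 2) :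
    HasSum (fun n : ℕ => reidemeisterZetaTerm doubling z (n + 1))
      (padicTwistedLog (2 * z) - padicTwistedLog z) := by
  have h2 : ‖2 * z‖ < 1 := by
    rw [norm_mul, Complex.norm_ofNat]; linarith
  have h := (hasSum_padicTwistedLog h2).sub (hasSum_padicTwistedLog (w := z) (by linarith))
  simp only [← reidemeisterZetaTerm_doubling] at h
  rw [hasSum_nat_add_iff 1]
  have h0 : reidemeisterZetaTerm doubling z 0 = 0 := by simp [reidemeisterZetaTerm]
  rwa [Finset.sum_range_one, h0, add_zero]

theorem reidemeisterZeta_doubling {z : ℂ} (hz : ‖z‖ < 1 / 2) :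
    reidemeisterZeta doubling z = Complex.exp (padicTwistedLog (2 * z) - padicTwistedLog z) := by
  rw [reidemeisterZeta, (hasSum_reidemeisterZetaTerm_doubling hz).tsum_eq]

theorem mapsTo_two_mul_ball :
    Set.MapsTo (fun z : ℂ => 2 * z) (Metric.ball 0 (1 / 2)) (Metric.ball 0 1) := by
  intro z hz
  rw [mem_ball_zero_iff] at hz ⊢
  rw [norm_mul, Complex.norm_ofNat]
  linarith

theorem differentiableOn_reidemeisterZeta_doubling :
    DifferentiableOn ℂ (reidemeisterZeta doubling) (Metric.ball 0 (1 / 2)) := by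
  have hA : DifferentiableOn ℂ padicTwistedLog (Metric.ball 0 1) :=
    differentiableOn_tsum_coeff_div_mul_pow norm_padicNorm_three_two_pow_sub_one_le
  have h : DifferentiableOn ℂ
      (fun z => Complex.exp (padicTwistedLog (2 * z) - padicTwistedLog z))
      (Metric.ball 0 (1 / 2)) := by
    refine DifferentiableOn.cexp (DifferentiableOn.sub ?_ ?_)
    · exact hA.comp (by fun_prop) mapsTo_two_mul_ball
    · exact hA.mono (Metric.ball_subset_ball (by norm_num))
  exact h.congr fun z hz => reidemeisterZeta_doubling (mem_ball_zero_iff.1 hz)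

theorem tendsto_reidemeisterZeta_doubling {r : ℕ} {ζ : ℂ} (hζ : ζ ^ 3 ^ r = 1) (h1 : ζ ≠ 1) :
    Tendsto (reidemeisterZeta doubling) (𝓝[Metric.ball 0 (1 / 2)] (1 / 2 * ζ)) (𝓝 0) := by
  have hm : Tendsto (fun z : ℂ => 2 * z) (𝓝[Metric.ball 0 (1 / 2)] (1 / 2 * ζ))
      (𝓝[Metric.ball 0 1] ζ) := by
    refine tendsto_nhdsWithin_iff.2 ⟨?_, ?_⟩
    · have h : Continuous fun z : ℂ => 2 * z := by fun_prop
      have := h.tendsto (1 / 2 * ζ)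
      rw [← mul_assoc, mul_one_div_cancel two_ne_zero, one_mul] at this
      exact this.mono_left nhdsWithin_le_nhds
    · filter_upwards [self_mem_nhdsWithin] with z hz using mapsTo_two_mul_ball hz
  have h := (tendsto_padicTwistedLog_re_atBot hζ h1).comp hm
  rw [tendsto_zero_iff_norm_tendsto_zero]
  -- The 2 is (1 - 1/2)⁻¹, which bounds A(z) on |z| < 1/2.
  refine squeeze_zero' (Eventually.of_forall fun _ => norm_nonneg _) ?_
    (Real.tendsto_exp_atBot.comp (tendsto_atBot_add_const_right _ 2 h))
  filter_upwards [self_mem_nhdsWithin] with z hz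
  rw [mem_ball_zero_iff] at hz
  rw [reidemeisterZeta_doubling hz, Complex.norm_exp, Complex.sub_re]
  have hb := norm_tsum_coeff_div_mul_pow_le norm_padicNorm_three_two_pow_sub_one_le hz.le
    (by norm_num)
  have hb2 := (Complex.abs_re_le_norm (padicTwistedLog z)).trans hb
  rw [abs_le] at hb2
  norm_num at hb2
  simp only [Function.comp]
  gcongr
  linarith

theorem exp_two_pi_mul_I_mul_div_pow (r : ℕ) (k : ℤ) :
    Complex.exp (2 * Real.pi * Complex.I * k / (3 : ℂ) ^ r) ^ 3 ^ r = 1 := by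
  rw [← Complex.exp_nat_mul, Complex.exp_eq_one_iff]
  refine ⟨k, ?_⟩
  push_cast
  field_simp

theorem exp_two_pi_mul_I_mul_div_pow_ne_one {r : ℕ} {k : ℤ} (hk : ¬ (3 : ℤ) ^ r ∣ k) :
    Complex.exp (2 * Real.pi * Complex.I * k / (3 : ℂ) ^ r) ≠ 1 := by
  rw [Ne, Complex.exp_eq_one_iff]
  rintro ⟨n, hn⟩
  apply hk
  refine ⟨n, ?_⟩
  have h0 := Complex.two_pi_I_ne_zero
  have h3 : (3 : ℂ) ^ r ≠ 0 := pow_ne_zero _ (by norm_num)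
  rw [div_eq_iff h3] at hn
  have : (k : ℂ) = 3 ^ r * n := mul_left_cancel₀ h0 (by linear_combination hn)
  exact_mod_cast this

theorem tendsto_reidemeisterZeta_doubling_exp {r : ℕ} {k : ℤ} (hk : ¬ (3 : ℤ) ^ r ∣ k) :
    Tendsto (reidemeisterZeta doubling)
      (𝓝[Metric.ball 0 (1 / 2)]
        ((1 / 2 : ℂ) * Complex.exp (2 * Real.pi * Complex.I * k / (3 : ℂ) ^ r))) (𝓝 0) :=
  tendsto_reidemeisterZeta_doubling (exp_two_pi_mul_I_mul_div_pow r k)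
    (exp_two_pi_mul_I_mul_div_pow_ne_one hk)

/-! ### Density of the zeros and the natural boundary -/

/-- Every real number is a limit from above of non-integral fractions `k / 3 ^ r`. -/
theorem exists_div_three_pow_near (t : ℝ) {ε : ℝ} (hε : 0 < ε) :
    ∃ (r : ℕ) (k : ℤ), ¬ (3 : ℤ) ^ r ∣ k ∧ 0 < k / (3 : ℝ) ^ r - t ∧ k / (3 : ℝ) ^ r - t < ε := by
  obtain ⟨s, hs⟩ := exists_pow_lt_of_lt_one (half_pos hε) (by norm_num : (1 / 3 : ℝ) < 1)
  set r := s + 1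
  have h3 : (0 : ℝ) < 3 ^ r := by positivity
  have hr : 2 / (3 : ℝ) ^ r < ε := by
    have h' : (1 / 3 : ℝ) ^ r ≤ (1 / 3) ^ s :=
      pow_le_pow_of_le_one (by norm_num) (by norm_num) (Nat.le_succ s)
    rw [one_div_pow] at h'
    have : 2 / (3 : ℝ) ^ r = 2 * (1 / 3 ^ r) := by ring
    rw [this]; linarith
  -- Of two consecutive integers at least one is prime to 3.
  obtain ⟨k, hk, hk1, hk2⟩ : ∃ k : ℤ, ¬ 3 ∣ k ∧ ⌊t * 3 ^ r⌋ + 1 ≤ k ∧ k ≤ ⌊t * 3 ^ r⌋ + 2 := by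
    by_cases h : (3 : ℤ) ∣ ⌊t * 3 ^ r⌋ + 1
    · exact ⟨⌊t * 3 ^ r⌋ + 2, by omega, by omega, le_rfl⟩
    · exact ⟨⌊t * 3 ^ r⌋ + 1, h, le_rfl, by omega⟩
  have hl := Int.lt_floor_add_one (t * 3 ^ r)
  have hu := Int.floor_le (t * 3 ^ r)
  have hk1' : (⌊t * 3 ^ r⌋ : ℝ) + 1 ≤ k := by exact_mod_cast hk1
  have hk2' : (k : ℝ) ≤ ⌊t * 3 ^ r⌋ + 2 := by exact_mod_cast hk2
  refine ⟨r, k, fun hd => hk ((dvd_pow_self 3 (Nat.succ_ne_zero s)).trans hd), ?_, ?_⟩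
  · rw [sub_pos, lt_div_iff₀ h3]; linarith
  · refine lt_of_le_of_lt ?_ hr
    rw [sub_le_iff_le_add, div_add' _ _ _ h3.ne', div_le_div_iff_of_pos_right h3]
    linarith

theorem frequently_exp_div_three_pow {p : ℂ} (hp : p ∈ Metric.sphere (0 : ℂ) (1 / 2)) :
    ∃ᶠ q in 𝓝[≠] p, ‖q‖ = 1 / 2 ∧ ∃ (r : ℕ) (k : ℤ), ¬ (3 : ℤ) ^ r ∣ k ∧
      q = 1 / 2 * Complex.exp (2 * Real.pi * Complex.I * k / (3 : ℂ) ^ r) := by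
  rw [mem_sphere_zero_iff_norm] at hp
  let e : ℝ → ℂ := fun x => 1 / 2 * Complex.exp (2 * Real.pi * Complex.I * x)
  have he : Continuous e := by fun_prop
  have henorm (x : ℝ) : ‖e x‖ = 1 / 2 := by
    have : 2 * Real.pi * Complex.I * x = ((2 * Real.pi * x : ℝ) : ℂ) * Complex.I := by
      push_cast; ring
    simp only [e]
    rw [this, norm_mul, Complex.norm_exp_ofReal_mul_I]
    norm_num
  obtain ⟨t, rfl⟩ : ∃ t : ℝ, e t = p := by
    refine ⟨p.arg / (2 * Real.pi), ?_⟩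
    have h := Complex.norm_mul_exp_arg_mul_I p
    rw [hp] at h
    have hpi : (Real.pi : ℂ) ≠ 0 := by exact_mod_cast Real.pi_ne_zero
    have e1 : 2 * Real.pi * Complex.I * ((p.arg / (2 * Real.pi) : ℝ) : ℂ) = p.arg * Complex.I := by
      push_cast; field_simp
    simp only [e]
    rw [e1]
    push_cast at h
    exact h
  rw [frequently_nhdsWithin_iff, Metric.nhds_basis_ball.frequently_iff]
  intro ε hε
  obtain ⟨δ, hδ, hδε⟩ := Metric.continuousAt_iff.1 (he.continuousAt (x := t)) ε hε
  -- `e` has period 1, so a gap strictly between 0 and 1 ensures a point different from `e t`.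
  obtain ⟨r, k, hk, h0, h1⟩ := exists_div_three_pow_near t (lt_min hδ one_pos)
  refine ⟨e (k / 3 ^ r), ?_, ⟨henorm _, r, k, hk, ?_⟩, ?_⟩
  · refine hδε ?_
    rw [Real.dist_eq, abs_of_pos h0]
    exact h1.trans_le (min_le_left _ _)
  · simp only [e]
    push_cast
    rw [mul_div_assoc]
  · intro h
    have h := mul_left_cancel₀ (by norm_num : (1 / 2 : ℂ) ≠ 0) h
    obtain ⟨n, hn⟩ := Complex.exp_eq_exp_iff_exists_int.1 h
    have h2 : (((k / 3 ^ r : ℝ) : ℝ) : ℂ) = t + n :=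
      mul_left_cancel₀ Complex.two_pi_I_ne_zero (by linear_combination hn)
    have h3 : (k / 3 ^ r : ℝ) = t + n := by exact_mod_cast h2
    rw [h3, add_sub_cancel_left] at h0 h1
    have h0' : 0 < n := by exact_mod_cast h0
    have h1' : n < 1 := by exact_mod_cast h1.trans_le (min_le_right _ _)
    omega

theorem nhdsWithin_ball_neBot_of_norm_eq {p : ℂ} {ρ : ℝ} (hρ : 0 < ρ) (hp : ‖p‖ = ρ) :
    (𝓝[Metric.ball 0 ρ] p).NeBot := by
  rw [← mem_closure_iff_nhdsWithin_neBot, closure_ball _ hρ.ne']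
  simp [hp]

theorem hasNaturalBoundaryCircle_reidemeisterZeta_doubling :
    HasNaturalBoundaryCircle (reidemeisterZeta doubling) (1 / 2) := by
  refine ⟨by norm_num, differentiableOn_reidemeisterZeta_doubling, ?_⟩
  rintro p hp ⟨g, hg, hgf⟩
  have hfreq : ∃ᶠ q in 𝓝[≠] p, g q = 0 := by
    have hcont : ∀ᶠ q in 𝓝 p, ContinuousAt g q :=
      hg.eventually_analyticAt.mono fun q hq => hq.continuousAt
    -- The agreement of g and R_φ near p also holds near each nearby boundary point q, so g q is the
    -- boundary limit 0.
    have hloc := eventually_eventually_nhds.2 (eventually_nhdsWithin_iff.1 hgf)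
    refine ((frequently_exp_div_three_pow hp).and_eventually
      ((hcont.and hloc).filter_mono nhdsWithin_le_nhds)).mono ?_
    rintro q ⟨⟨hq, r, k, hk, rfl⟩, hc, hl⟩
    have := nhdsWithin_ball_neBot_of_norm_eq (by norm_num) hq
    exact tendsto_nhds_unique (hc.tendsto.mono_left nhdsWithin_le_nhds)
      ((tendsto_reidemeisterZeta_doubling_exp hk).congr'
        ((eventually_nhdsWithin_iff.2 hl).mono fun _ h => h.symm))
  have hzero := (hg.frequently_zero_iff_eventually_zero.1 hfreq).filter_mono
    (nhdsWithin_le_nhds (s := Metric.ball 0 (1 / 2)))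
  have := nhdsWithin_ball_neBot_of_norm_eq (by norm_num) (mem_sphere_zero_iff_norm.1 hp)
  obtain ⟨z, hz0, hz⟩ := (hzero.and hgf).exists
  rw [hz0] at hz
  exact Complex.exp_ne_zero _ hz.symm

theorem mainTheorem11 :
    (∀ j : ℕ, 1 ≤ j →
      Finite (TwistedConjClasses (doubling ^ j)) ∧
      (reidemeisterNumber (doubling ^ j) : ℚ) =
        |(2 : ℚ) ^ j - 1| * padicNorm 3 ((2 : ℚ) ^ j - 1)) ∧
    (∀ z ∈ Metric.ball (0 : ℂ) (1 / 2),
      Summable (fun n : ℕ => reidemeisterZetaTerm doubling z (n + 1))) ∧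
    HasNaturalBoundaryCircle (reidemeisterZeta doubling) (1 / 2) ∧
    (∀ (r : ℕ) (k : ℤ), ¬ (3 : ℤ) ^ r ∣ k →
      Tendsto (reidemeisterZeta doubling)
        (𝓝[Metric.ball 0 (1 / 2)]
          ((1 / 2 : ℂ) * Complex.exp (2 * Real.pi * Complex.I * k / (3 : ℂ) ^ r)))
        (𝓝 0)) := by
  refine ⟨fun j hj => finite_and_reidemeisterNumber_doubling_pow hj, fun z hz =>
    (hasSum_reidemeisterZetaTerm_doubling (mem_ball_zero_iff.1 hz)).summable,
    hasNaturalBoundaryCircle_reidemeisterZeta_doubling,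
    fun r k hk => tendsto_reidemeisterZeta_doubling_exp hk⟩
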